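/- Let $\mathbb{F}_q$ be the finite field with $q$ elements. The reduced degree of a map $\varphi:\mathbb{F}_q\to\mathbb{F}_q$ is the degree of the unique polynomial over $\mathbb{F}_q$ of degree less than $q$ that induces $\varphi$; the reduced degree of a polynomial $f\in\mathbb{F}_q[x]$ is that of the map $x\mapsto f(x)$. A polynomial $f\in\mathbb{F}_q[x]$ is an orthomorphism polynomial if both $x\mapsto f(x)$ and $x\mapsto f(x)-x$ are permutations of $\mathbb{F}_q$. There exists an orthomorphism polynomial over $\mathbb{F}_q$ of reduced degree exactly $q-3$ if and only if $q\notin\{2,3,5,8\}$. Moreover, if $q>3$, then every orthomorphism polynomial over $\mathbb{F}_q$ has reduced degree at most $q-3$. -/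

import Mathlib

open Polynomial

/-- A polynomial over `F` is a permutation polynomial if `x ↦ f(x)` is a permutation of `F`. -/
def IsPermutationPolynomial {F : Type*} [Field F] (f : F[X]) : Prop :=
  Function.Bijective (fun x : F => f.eval x)

/-- An orthomorphism polynomial is a permutation polynomial `f` such that `x ↦ f(x) - x` is also
a permutation of `F`. -/
def IsOrthomorphismPolynomial {F : Type*} [Field F] (f : F[X]) : Prop :=
  IsPermutationPolynomial f ∧ Function.Bijective (fun x : F => f.eval x - x)

open Classical in
/-- The reduced polynomial of a map `φ` from a finite field `F` to itself: the unique polynomial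
of degree less than `|F|` that induces `φ` (see `degree_reducedPolynomial_lt`,
`eval_reducedPolynomial` and `eq_reducedPolynomial`). -/
noncomputable def reducedPolynomial {F : Type*} [Field F] [Fintype F] (φ : F → F) : F[X] :=
  Lagrange.interpolate Finset.univ (fun x : F => x) φ

/-- The reduced degree of a map from a finite field to itself: the degree of its reduced
polynomial. -/
noncomputable def reducedDegree {F : Type*} [Field F] [Fintype F] (φ : F → F) : ℕ :=
  (reducedPolynomial φ).natDegree

theorem degree_reducedPolynomial_lt {F : Type*} [Field F] [Fintype F] (φ : F → F) :
    (reducedPolynomial φ).degree < Fintype.card F := by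
  classical
  have h := Lagrange.degree_interpolate_lt (s := Finset.univ) (v := fun x : F => x) φ
    (fun _ _ _ _ h => h)
  rw [Finset.card_univ] at h
  unfold reducedPolynomial
  convert h

theorem eval_reducedPolynomial {F : Type*} [Field F] [Fintype F] (φ : F → F) (x : F) :
    (reducedPolynomial φ).eval x = φ x := by
  classical
  have h := Lagrange.eval_interpolate_at_node (s := Finset.univ) (v := fun x : F => x) φ
    (fun _ _ _ _ h => h) (Finset.mem_univ x)
  unfold reducedPolynomial
  convert h

theorem eq_reducedPolynomial {F : Type*} [Field F] [Fintype F] (φ : F → F) (f : F[X])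
    (hdeg : f.degree < Fintype.card F) (hf : ∀ x, f.eval x = φ x) :
    f = reducedPolynomial φ := by
  refine Polynomial.eq_of_degrees_lt_of_eval_finset_eq Finset.univ ?_ ?_ ?_
  · rwa [Finset.card_univ]
  · rw [Finset.card_univ]
    exact degree_reducedPolynomial_lt φ
  · intro x _
    rw [hf, eval_reducedPolynomial]

/-!
The bound is a statement about power moments: the coefficient of `x ^ (q - 1 - k)` in a reduced
polynomial of degree at most `q - 1 - k` is `-∑ φ(x) x ^ k`. For `k = 0` this vanishes because `φ`
is a permutation. For `k = 1`, expand the second elementary symmetric function of the values of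
`φ = (φ - id) + id`: those of `φ`, `φ - id` and `id` are all equal to that of the whole field, which
is zero for `q > 3`, and what remains of the expansion is `∑ φ(x) x`. This works in every
characteristic (`IsOrthomorphism.reducedDegree_le`).

For existence, two orthomorphisms that differ on exactly three points have a difference with `q - 3`
roots, so one of them has reduced degree `q - 3`. An orthomorphism `φ` can be modified on three
points `a`, `b`, `c` as soon as `φ b - φ c = a - c` and `φ c - φ a = b - a`
(`exists_reducedDegree_of_switch`). For additive `φ` such a triple is given by a plane on which
`φ ^ 2 - φ + 1 = 0`; an additive `φ` of this kind exists whenever `F` has dimension at least two over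
its prime field, except when `q = 8`, where the complement of the plane is a line over the field of
two elements (`exists_reducedDegree_of_two_le_finrank`). For the prime fields `φ` is multiplication
by one constant on the squares and by another on the non-squares; switches are found explicitly,
according to the quadratic characters of `-3`, `-1`, `2` and `5` (`exists_reducedDegree_of_char`).

In the fields with 3 and 5 elements the degree `q - 3` is 0 or 2, impossible for a permutation. In
the field with eight elements, the vanishing of the sums of the cubes of `φ` and of `φ - id`
determines a polynomial of degree 5 up to affine changes and one parameter, and none of the
remaining candidates is an orthomorphism (`not_isOrthomorphism_of_card_eq_eight`).
-/

/-! ### The second elementary symmetric function -/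

/-- The second elementary symmetric function `∑_{i < j} f i * f j` of the family `f` on `s`, read
off as a coefficient of `∏ (1 + f i X)`, so that no order on the index type is needed. -/
noncomputable def esymmTwo {F ι : Type*} [CommRing F] (s : Finset ι) (f : ι → F) : F :=
  (∏ i ∈ s, (1 + C (f i) * X)).coeff 2

section EsymmTwo

variable {F ι : Type*} [CommRing F]

theorem coeff_mul_one_add_C_mul_X (P : F[X]) (a : F) (n : ℕ) :
    ((1 + C a * X) * P).coeff (n + 1) = P.coeff (n + 1) + a * P.coeff n := by
  rw [show (1 + C a * X) * P = P + C a * (P * X) by ring, coeff_add, coeff_C_mul, coeff_mul_X]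

theorem coeff_zero_prod_one_add (s : Finset ι) (f : ι → F) :
    (∏ i ∈ s, (1 + C (f i) * X)).coeff 0 = 1 := by
  simp [coeff_zero_eq_eval_zero, eval_prod]

theorem coeff_one_prod_one_add (s : Finset ι) (f : ι → F) :
    (∏ i ∈ s, (1 + C (f i) * X)).coeff 1 = ∑ i ∈ s, f i := by
  classical
  induction s using Finset.induction_on with
  | empty => simp [coeff_one]
  | insert a s ha ih =>
    rw [Finset.prod_insert ha, Finset.sum_insert ha, coeff_mul_one_add_C_mul_X, ih,
      coeff_zero_prod_one_add]
    ring

theorem esymmTwo_empty (f : ι → F) : esymmTwo ∅ f = 0 := by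
  simp [esymmTwo, coeff_one]

theorem esymmTwo_insert [DecidableEq ι] {a : ι} {s : Finset ι} (ha : a ∉ s) (f : ι → F) :
    esymmTwo (insert a s) f = esymmTwo s f + f a * ∑ i ∈ s, f i := by
  rw [esymmTwo, Finset.prod_insert ha, coeff_mul_one_add_C_mul_X, coeff_one_prod_one_add, esymmTwo]

theorem esymmTwo_add (s : Finset ι) (g h : ι → F) :
    esymmTwo s (fun i => g i + h i) = esymmTwo s g + esymmTwo s h
      + (∑ i ∈ s, g i) * (∑ i ∈ s, h i) - ∑ i ∈ s, g i * h i := by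
  classical
  induction s using Finset.induction_on with
  | empty => simp [esymmTwo_empty]
  | insert a s ha ih =>
    simp only [esymmTwo_insert ha, ih, Finset.sum_insert ha, Finset.sum_add_distrib]
    ring

theorem esymmTwo_const_mul (s : Finset ι) (c : F) (f : ι → F) :
    esymmTwo s (fun i => c * f i) = c ^ 2 * esymmTwo s f := by
  classical
  induction s using Finset.induction_on with
  | empty => simp [esymmTwo_empty]
  | insert a s ha ih =>
    simp only [esymmTwo_insert ha, ih, ← Finset.mul_sum]
    ring

theorem esymmTwo_of_bijective [Fintype F] {φ : F → F} (hφ : Function.Bijective φ) :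
    esymmTwo Finset.univ φ = esymmTwo Finset.univ (fun x : F => x) := by
  rw [esymmTwo, esymmTwo, hφ.prod_comp (fun x : F => 1 + C x * X)]

end EsymmTwo

/-! ### The degree bound -/

theorem natDegree_le_of_coeff_eq_zero {R : Type*} [Semiring R] {f : R[X]} {n : ℕ}
    (hd : f.natDegree ≤ n + 1) (h : f.coeff (n + 1) = 0) : f.natDegree ≤ n := by
  rw [natDegree_le_iff_coeff_eq_zero] at hd ⊢
  intro m hm
  rcases (Nat.succ_le_of_lt hm).eq_or_lt with rfl | h'
  · exact h
  · exact hd m h'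

section Degree

variable {F : Type*} [Field F] [Fintype F]

theorem esymmTwo_univ (hq : 3 < Fintype.card F) :
    esymmTwo Finset.univ (fun x : F => x) = 0 := by
  classical
  obtain ⟨c, hc⟩ : ∃ c : F, c ∉ ({0, 1, -1} : Finset F) := by
    by_contra! h
    have := Finset.card_le_card (fun x _ => h x : (Finset.univ : Finset F) ⊆ {0, 1, -1})
    have := Finset.card_le_three (a := (0 : F)) (b := 1) (c := -1)
    rw [Finset.card_univ] at *
    omega
  simp only [Finset.mem_insert, Finset.mem_singleton, not_or] at hc
  -- Multiplication by `c` permutes `F`, and multiplies the symmetric function by `c ^ 2 ≠ 1`.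
  have h := esymmTwo_of_bijective (mulLeft_bijective₀ c hc.1)
  rw [esymmTwo_const_mul] at h
  have h2 : (c - 1) * (c - -1) * esymmTwo Finset.univ (fun x : F => x) = 0 := by
    linear_combination h
  exact (mul_eq_zero.1 h2).resolve_left
    (mul_ne_zero (sub_ne_zero.2 hc.2.1) (sub_ne_zero.2 hc.2.2))

/-- A map `φ` such that both `φ` and `x ↦ φ x - x` are bijective. -/
def IsOrthomorphism {F : Type*} [Field F] (φ : F → F) : Prop :=
  Function.Bijective φ ∧ Function.Bijective (fun x => φ x - x)

theorem IsOrthomorphism.sum_mul_eq_zero {φ : F → F} (hφ : IsOrthomorphism φ)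
    (hq : 3 < Fintype.card F) : ∑ x : F, φ x * x = 0 := by
  have h1 : ∑ x : F, x = 0 := by
    simpa using FiniteField.sum_pow_lt_card_sub_one F 1 (by omega)
  have h2 : ∑ x : F, x * x = 0 := by
    simpa [pow_two] using FiniteField.sum_pow_lt_card_sub_one F 2 (by omega)
  have h := esymmTwo_add Finset.univ (fun x : F => φ x - x) (fun x => x)
  simp only [sub_add_cancel] at h
  rw [esymmTwo_of_bijective hφ.1, esymmTwo_of_bijective hφ.2, esymmTwo_univ hq, h1] at h
  simp only [sub_mul, Finset.sum_sub_distrib, h2] at h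
  linear_combination h

theorem sum_pow_card_sub_one : ∑ x : F, x ^ (Fintype.card F - 1) = -1 := by
  classical
  have hq := Fintype.one_lt_card (α := F)
  have h : ∀ x : F, x ^ (Fintype.card F - 1) = 1 - if x = 0 then 1 else 0 := by
    intro x
    by_cases hx : x = 0
    · simp [hx, zero_pow (Nat.sub_ne_zero_of_lt hq)]
    · simp [hx, FiniteField.pow_card_sub_one_eq_one x hx]
  simp [h]

/-- The coefficients of a polynomial of degree at most `q - 1 - k` seen through the power moments
of its values: only the exponent `q - 1` contributes to `∑ f(x) x ^ k`. -/
theorem coeff_eq_neg_sum {f : F[X]} {d k : ℕ} (hd : f.natDegree ≤ d)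
    (hk : d + k + 1 = Fintype.card F) : f.coeff d = -∑ x : F, f.eval x * x ^ k := by
  have h : ∀ x : F, f.eval x * x ^ k = ∑ j ∈ Finset.range (d + 1), f.coeff j * x ^ (j + k) := by
    intro x
    rw [eval_eq_sum_range' (Nat.lt_succ_of_le hd), Finset.sum_mul]
    exact Finset.sum_congr rfl fun j _ => by ring
  simp only [h]
  rw [Finset.sum_comm]
  simp only [← Finset.mul_sum]
  rw [Finset.sum_range_succ, Finset.sum_eq_zero, show d + k = Fintype.card F - 1 by omega,
    sum_pow_card_sub_one]
  · ring
  · intro j hj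
    rw [Finset.mem_range] at hj
    rw [FiniteField.sum_pow_lt_card_sub_one F _ (by omega), mul_zero]

theorem IsOrthomorphism.reducedDegree_le {φ : F → F} (hφ : IsOrthomorphism φ)
    (hq : 3 < Fintype.card F) : reducedDegree φ + 3 ≤ Fintype.card F := by
  obtain ⟨n, hn⟩ : ∃ n, Fintype.card F = n + 3 := ⟨_, (Nat.sub_add_cancel hq.le).symm⟩
  have h0 : (reducedPolynomial φ).natDegree ≤ n + 2 := by
    have h := natDegree_le_of_degree_le (n := n + 2)
      (Order.le_of_lt_succ (hn ▸ degree_reducedPolynomial_lt φ))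
    exact h
  have h1 : (reducedPolynomial φ).natDegree ≤ n + 1 := by
    refine natDegree_le_of_coeff_eq_zero h0 ?_
    rw [coeff_eq_neg_sum (k := 0) h0 hn.symm]
    simp only [eval_reducedPolynomial, pow_zero, mul_one, neg_eq_zero]
    rw [hφ.1.sum_comp (fun x : F => x)]
    simpa using FiniteField.sum_pow_lt_card_sub_one F 1 (by omega)
  have h2 : (reducedPolynomial φ).natDegree ≤ n := by
    refine natDegree_le_of_coeff_eq_zero h1 ?_
    rw [coeff_eq_neg_sum (k := 1) h1 hn.symm]
    simp only [eval_reducedPolynomial, pow_one, neg_eq_zero]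
    exact hφ.sum_mul_eq_zero hq
  rw [reducedDegree, hn]
  omega

/-! ### Switching an orthomorphism on three points -/

/-- Two orthomorphisms that differ, but on at most three points, cannot both have reduced degree
below `q - 3`: their difference has at least `q - 3` roots. -/
theorem exists_reducedDegree_of_eq_off_three {φ ψ : F → F} (hq : 3 < Fintype.card F)
    (hφ : IsOrthomorphism φ) (hψ : IsOrthomorphism ψ) {a b c : F} (hne : φ a ≠ ψ a)
    (h : ∀ x, x ≠ a → x ≠ b → x ≠ c → φ x = ψ x) :
    ∃ θ : F → F, IsOrthomorphism θ ∧ reducedDegree θ + 3 = Fintype.card F := by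
  classical
  by_contra! hcon
  have h1 := (hφ.reducedDegree_le hq).lt_of_ne (hcon φ hφ)
  have h2 := (hψ.reducedDegree_le hq).lt_of_ne (hcon ψ hψ)
  unfold reducedDegree at h1 h2
  have hc : Fintype.card F - 3 ≤ (Finset.univ \ {a, b, c} : Finset F).card := by
    have := Finset.le_card_sdiff {a, b, c} (Finset.univ : Finset F)
    have := Finset.card_le_three (a := a) (b := b) (c := c)
    rw [Finset.card_univ] at *
    omega
  have h3 : reducedPolynomial φ = reducedPolynomial ψ := by
    refine eq_of_natDegree_lt_card_of_eval_eq' _ _ (Finset.univ \ {a, b, c}) ?_ ?_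
    · intro x hx
      simp only [Finset.mem_sdiff, Finset.mem_univ, Finset.mem_insert, Finset.mem_singleton,
        true_and, not_or] at hx
      rw [eval_reducedPolynomial, eval_reducedPolynomial, h x hx.1 hx.2.1 hx.2.2]
    · exact lt_of_lt_of_le (max_lt (by omega) (by omega)) hc
  apply hne
  rw [← eval_reducedPolynomial φ a, h3, eval_reducedPolynomial]

/-- If `φ b - φ c = a - c` and `φ c - φ a = b - a`, then permuting the values of `φ` cyclically on
`a`, `b`, `c` permutes the values of `x ↦ φ x - x` cyclically in the opposite direction, and so
gives another orthomorphism. -/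
theorem exists_reducedDegree_of_switch {φ : F → F} (hq : 3 < Fintype.card F)
    (hφ : IsOrthomorphism φ) {a b c : F} (hab : a ≠ b) (hac : a ≠ c) (hbc : b ≠ c)
    (h1 : φ b - φ c = a - c) (h2 : φ c - φ a = b - a) :
    ∃ θ : F → F, IsOrthomorphism θ ∧ reducedDegree θ + 3 = Fintype.card F := by
  classical
  -- The cycle `a ↦ b ↦ c ↦ a`.
  let σ : Equiv.Perm F := Equiv.swap a b * Equiv.swap b c
  have ha : σ a = b := by
    simp [σ, Equiv.swap_apply_of_ne_of_ne hab hac]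
  have hb : σ b = c := by
    simp [σ, Equiv.swap_apply_of_ne_of_ne hac.symm hbc.symm]
  have hc : σ c = a := by simp [σ]
  have hx : ∀ x, x ≠ a → x ≠ b → x ≠ c → σ x = x := by
    intro x hxa hxb hxc
    simp [σ, Equiv.swap_apply_of_ne_of_ne hxb hxc, Equiv.swap_apply_of_ne_of_ne hxa hxb]
  have key : ∀ x, φ (σ x) - x = φ (σ.symm x) - σ.symm x := by
    intro x
    by_cases hxa : x = a
    · rw [hxa, ha, σ.symm_apply_eq.2 hc.symm]; linear_combination h1
    by_cases hxb : x = b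
    · rw [hxb, hb, σ.symm_apply_eq.2 ha.symm]; linear_combination h2
    by_cases hxc : x = c
    · rw [hxc, hc, σ.symm_apply_eq.2 hb.symm]; linear_combination -h1 - h2
    have h := hx x hxa hxb hxc
    rw [h, σ.symm_apply_eq.2 h.symm]
  refine exists_reducedDegree_of_eq_off_three (ψ := fun x => φ (σ x)) (a := a) (b := b) (c := c)
    hq hφ ⟨hφ.1.comp σ.bijective, ?_⟩ ?_ ?_
  · simp only [key]
    exact hφ.2.comp σ.symm.bijective
  · simp only [ha]
    exact fun h => hab (hφ.1.injective h)
  · intro x hxa hxb hxc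
    simp only [hx x hxa hxb hxc]

end Degree

/-! ### Additive orthomorphisms -/

section Additive

variable {F : Type*} [Field F] [Fintype F]

/-- The three points of the switch are `0`, `M v`, `v`: on the plane they span, `M` is a root of
`T ^ 2 - T + 1`. -/
theorem exists_reducedDegree_of_addEquiv (hq : 3 < Fintype.card F) {V : Type*} [AddCommGroup V]
    (e : F ≃+ V) (M : V →+ V) (h0 : ∀ v, M v = 0 → v = 0) (h1 : ∀ v, M v = v → v = 0)
    {v : V} (hv : v ≠ 0) (hM : M (M v) = M v - v) :
    ∃ θ : F → F, IsOrthomorphism θ ∧ reducedDegree θ + 3 = Fintype.card F := by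
  have hφ : IsOrthomorphism fun x : F => e.symm (M (e x)) := by
    refine ⟨Finite.injective_iff_bijective.1 fun x y h => ?_,
      Finite.injective_iff_bijective.1 fun x y h => ?_⟩
    · have h' : M (e (x - y)) = 0 := by
        rw [map_sub, map_sub, sub_eq_zero]
        exact e.symm.injective h
      simpa [sub_eq_zero] using h0 _ h'
    · have h' : M (e (x - y)) = e (x - y) := by
        apply e.symm.injective
        simp only [map_sub, AddEquiv.symm_apply_apply]
        have h2 : e.symm (M (e x)) - x = e.symm (M (e y)) - y := h
        linear_combination h2
      simpa [sub_eq_zero] using h1 _ h'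
  have hMv : M v ≠ 0 := fun h => hv (h0 v h)
  refine exists_reducedDegree_of_switch hq hφ (a := 0) (b := e.symm (M v)) (c := e.symm v)
    ?_ ?_ ?_ ?_ ?_
  · exact fun h => hMv (by simpa using h.symm)
  · exact fun h => hv (by simpa using h.symm)
  · simpa using fun h => hv (h1 v h)
  · simp [hM]
  · simp

theorem exists_reducedDegree_of_sq_sub_add_one (hq : 3 < Fintype.card F) {s : F}
    (hs : s ^ 2 - s + 1 = 0) :
    ∃ θ : F → F, IsOrthomorphism θ ∧ reducedDegree θ + 3 = Fintype.card F := by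
  have hs0 : s ≠ 0 := by rintro rfl; simp at hs
  have hs1 : s - 1 ≠ 0 := by
    intro h
    rw [sub_eq_zero.1 h] at hs
    simp at hs
  refine exists_reducedDegree_of_addEquiv hq (AddEquiv.refl F) (AddMonoidHom.mulLeft s)
    (fun v h => ?_) (fun v h => ?_) one_ne_zero ?_
  · exact (mul_eq_zero.1 h).resolve_left hs0
  · refine (mul_eq_zero.1 (?_ : (s - 1) * v = 0)).resolve_left hs1
    have h' : s * v = v := h
    linear_combination h'
  · simp only [AddMonoidHom.coe_mulLeft]
    linear_combination hs

/-- A space over `ZMod p` other than a line over `ZMod 2` has an automorphism without fixed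
vectors: identify it with a finite field and multiply by an element other than `0` and `1`. -/
theorem exists_linearMap_without_eigenvalue_zero_one (p : ℕ) [Fact p.Prime] (W : Type*)
    [AddCommGroup W] [Module (ZMod p) W] [Module.Finite (ZMod p) W]
    (hpn : ¬(p = 2 ∧ Module.finrank (ZMod p) W = 1)) :
    ∃ T : W →ₗ[ZMod p] W, (∀ w, T w = 0 → w = 0) ∧ ∀ w, T w = w → w = 0 := by
  classical
  rcases Nat.eq_zero_or_pos (Module.finrank (ZMod p) W) with hn | hn
  · have := Module.finrank_zero_iff.1 hn
    exact ⟨0, fun w _ => Subsingleton.elim _ _, fun w _ => Subsingleton.elim _ _⟩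
  · set n := Module.finrank (ZMod p) W with hn_def
    have hp := (Fact.out : p.Prime)
    let _ : Fintype (GaloisField p n) := Fintype.ofFinite _
    have hcard : Fintype.card (GaloisField p n) = p ^ n := by
      rw [← Nat.card_eq_fintype_card, GaloisField.card p n hn.ne']
    have h2 : 2 < p ^ n := by
      rcases hp.two_le.eq_or_lt with h | h
      · have hn2 : 2 ≤ n := by
          by_contra
          exact hpn ⟨h.symm, by omega⟩
        calc 2 < 2 ^ 2 := by norm_num
          _ ≤ p ^ n := h ▸ Nat.pow_le_pow_right (by norm_num) hn2
      · exact h.trans_le (Nat.le_self_pow hn.ne' p)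
    obtain ⟨t, ht⟩ : ∃ t : GaloisField p n, t ∉ ({0, 1} : Finset (GaloisField p n)) := by
      by_contra! h
      have := Finset.card_le_card
        (fun x _ => h x : (Finset.univ : Finset (GaloisField p n)) ⊆ {0, 1})
      have := Finset.card_le_two (a := (0 : GaloisField p n)) (b := 1)
      rw [Finset.card_univ] at *
      omega
    simp only [Finset.mem_insert, Finset.mem_singleton, not_or] at ht
    let e : W ≃ₗ[ZMod p] GaloisField p n :=
      LinearEquiv.ofFinrankEq _ _ (by rw [GaloisField.finrank p hn.ne'])
    refine ⟨e.symm.toLinearMap ∘ₗ LinearMap.mulLeft (ZMod p) t ∘ₗ e.toLinearMap, ?_, ?_⟩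
    · intro w hw
      simpa [ht.1] using hw
    · intro w hw
      have h : t * e w = e w := by
        apply e.symm.injective
        simpa using hw
      have h' : (t - 1) * e w = 0 := by linear_combination h
      simpa using (mul_eq_zero.1 h').resolve_left (sub_ne_zero.2 ht.2)

/-- A space of dimension at least two splits off a plane, on which the companion matrix of
`T ^ 2 - T + 1` acts. -/
theorem exists_reducedDegree_of_two_le_finrank (p : ℕ) [Fact p.Prime] [Module (ZMod p) F]
    (hq : 3 < Fintype.card F) (hm : 2 ≤ Module.finrank (ZMod p) F)
    (h8 : ¬(p = 2 ∧ Module.finrank (ZMod p) F = 3)) :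
    ∃ θ : F → F, IsOrthomorphism θ ∧ reducedDegree θ + 3 = Fintype.card F := by
  obtain ⟨n, hn⟩ := Nat.exists_eq_add_of_le hm
  obtain ⟨T, hT0, hT1⟩ := exists_linearMap_without_eigenvalue_zero_one p (Fin n → ZMod p)
    (by rw [Module.finrank_fin_fun]; omega)
  let e : F ≃ₗ[ZMod p] (ZMod p × ZMod p) × (Fin n → ZMod p) :=
    LinearEquiv.ofFinrankEq _ _ (by simp [Module.finrank_prod, hn])
  let M : (ZMod p × ZMod p) × (Fin n → ZMod p) →+ (ZMod p × ZMod p) × (Fin n → ZMod p) :=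
    { toFun := fun v => ((-v.1.2, v.1.1 + v.1.2), T v.2)
      map_zero' := by simp
      map_add' := fun v w => by
        ext <;> simp <;> ring }
  have hM : ∀ v, M v = ((-v.1.2, v.1.1 + v.1.2), T v.2) := fun _ => rfl
  refine exists_reducedDegree_of_addEquiv hq e.toAddEquiv M ?_ ?_ (v := ((1, 0), 0)) ?_ ?_
  · rintro ⟨⟨u, v⟩, w⟩ h
    simp only [hM, Prod.mk_eq_zero] at h ⊢
    obtain ⟨⟨ha, hb⟩, hc⟩ := h
    exact ⟨⟨by linear_combination hb + ha, by linear_combination -ha⟩, hT0 w hc⟩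
  · rintro ⟨⟨u, v⟩, w⟩ h
    simp only [hM, Prod.mk_eq_zero, Prod.mk.injEq] at h ⊢
    obtain ⟨⟨ha, hb⟩, hc⟩ := h
    exact ⟨⟨by linear_combination hb, by linear_combination -ha - hb⟩, hT1 w hc⟩
  · simp
  · simp [hM]

end Additive

/-! ### Quadratic orthomorphisms -/

theorem not_isSquare_of_eq_mul_sq {K : Type*} [Field K] {a b r : K} (ha : ¬IsSquare a) (hr : r ≠ 0)
    (h : b = a * r ^ 2) : ¬IsSquare b := by
  rintro ⟨w, hw⟩
  refine ha ⟨w / r, ?_⟩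
  field_simp
  linear_combination hw - h

section Quadratic

variable {F : Type*} [Field F] [Fintype F]

open Classical in
/-- The map that multiplies squares by `s` and non-squares by `t`. -/
noncomputable def quadraticMap (s t x : F) : F := if IsSquare x then s * x else t * x

theorem quadraticMap_of_isSquare {x : F} (s t : F) (hx : IsSquare x) :
    quadraticMap s t x = s * x := if_pos hx

theorem quadraticMap_of_not_isSquare {x : F} (s t : F) (hx : ¬IsSquare x) :
    quadraticMap s t x = t * x := if_neg hx

/-- If `s` and `t` have the same nonzero quadratic character, then `quadraticMap s t` multiplies
all quadratic characters by this constant, and so `x` can be recovered from its image. -/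
theorem bijective_quadraticMap [DecidableEq F] {s t : F} (hs : s ≠ 0)
    (hst : quadraticChar F s = quadraticChar F t) : Function.Bijective (quadraticMap s t) := by
  have hs' : quadraticChar F s ≠ 0 := by rwa [Ne, quadraticChar_eq_zero_iff]
  have ht : t ≠ 0 := by rwa [hst, Ne, quadraticChar_eq_zero_iff] at hs'
  have hχ : ∀ x, quadraticChar F (quadraticMap s t x) = quadraticChar F s * quadraticChar F x := by
    intro x
    by_cases hx : IsSquare x
    · rw [quadraticMap_of_isSquare s t hx, map_mul]
    · rw [quadraticMap_of_not_isSquare s t hx, map_mul, hst]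
  refine Finite.injective_iff_bijective.1 fun x y h => ?_
  have hxy : quadraticChar F x = quadraticChar F y := by
    apply mul_left_cancel₀ hs'
    rw [← hχ, ← hχ, h]
  by_cases hx : IsSquare x
  · have hy : IsSquare y := by
      by_contra hy
      rw [quadraticChar_neg_one_iff_not_isSquare.2 hy, quadraticChar_neg_one_iff_not_isSquare] at hxy
      exact hxy hx
    rw [quadraticMap_of_isSquare s t hx, quadraticMap_of_isSquare s t hy] at h
    exact mul_left_cancel₀ hs h
  · have hy : ¬IsSquare y := by
      rwa [← quadraticChar_neg_one_iff_not_isSquare, ← hxy, quadraticChar_neg_one_iff_not_isSquare]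
    rw [quadraticMap_of_not_isSquare s t hx, quadraticMap_of_not_isSquare s t hy] at h
    exact mul_left_cancel₀ ht h

theorem IsOrthomorphism.quadraticMap [DecidableEq F] {s t : F} (hs : s ≠ 0) (hs1 : s - 1 ≠ 0)
    (h0 : quadraticChar F s = quadraticChar F t)
    (h1 : quadraticChar F (s - 1) = quadraticChar F (t - 1)) :
    IsOrthomorphism (quadraticMap s t) := by
  refine ⟨bijective_quadraticMap hs h0, ?_⟩
  convert bijective_quadraticMap hs1 h1 using 1
  funext x
  by_cases hx : IsSquare x
  · simp only [quadraticMap_of_isSquare _ _ hx]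
    ring
  · simp only [quadraticMap_of_not_isSquare _ _ hx]
    ring

/-- The switch takes place on the squares `x`, `1` and the non-square `c = s x + (1 - s)`; this
forces the second multiplier `t = (1 + (s - 1) x) / c`. -/
theorem exists_reducedDegree_of_not_isSquare (hq : 3 < Fintype.card F) {s x : F} (hx : IsSquare x)
    (hA : ¬IsSquare (s * x + (1 - s))) (hB : ¬IsSquare (s * (1 + (s - 1) * x)))
    (hC : ¬IsSquare ((s - 1) * (s - x))) :
    ∃ θ : F → F, IsOrthomorphism θ ∧ reducedDegree θ + 3 = Fintype.card F := by
  classical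
  obtain ⟨c, hc⟩ : ∃ c, s * x + (1 - s) = c := ⟨_, rfl⟩
  rw [hc] at hA
  have hc0 : c ≠ 0 := by rintro rfl; exact hA IsSquare.zero
  have hs0 : s ≠ 0 := by rintro rfl; simp at hB
  have hs1 : s - 1 ≠ 0 := by
    intro h
    rw [h, zero_mul] at hC
    exact hC IsSquare.zero
  obtain ⟨t, ht⟩ : ∃ t, t * c = 1 + (s - 1) * x := ⟨_, div_mul_cancel₀ _ hc0⟩
  have ht1 : (t - 1) * c = s - x := by linear_combination ht + hc
  rw [← ht] at hB
  rw [← ht1] at hC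
  -- In both cases a product `u * (v * c)` of character `-1` with `c` of character `-1`.
  have key : ∀ u v : F, u ≠ 0 → ¬IsSquare (u * (v * c)) →
      quadraticChar F u = quadraticChar F v := by
    intro u v hu h
    rw [← quadraticChar_neg_one_iff_not_isSquare] at h hA
    rw [map_mul, map_mul, hA] at h
    rcases quadraticChar_dichotomy hu with h' | h' <;> rw [h'] at h ⊢ <;> linarith
  have hφ := IsOrthomorphism.quadraticMap hs0 hs1 (key s t hs0 hB) (key _ _ hs1 hC)
  have h1 : IsSquare (1 : F) := IsSquare.one
  refine exists_reducedDegree_of_switch hq hφ (a := x) (b := 1) (c := c) ?_ ?_ ?_ ?_ ?_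
  · rintro rfl
    apply hA
    rwa [← hc, show s * 1 + (1 - s) = (1 : F) by ring]
  · rintro rfl
    exact hA hx
  · rintro rfl
    exact hA h1
  · rw [quadraticMap_of_isSquare s t h1, quadraticMap_of_not_isSquare s t hA]
    linear_combination -hc - ht
  · rw [quadraticMap_of_isSquare s t hx, quadraticMap_of_not_isSquare s t hA]
    linear_combination ht

/-- Apart from the characteristics 2, 3 and 5, one of the following gives an admissible switch.
* If `-3` is a square, then `T ^ 2 - T + 1` has a root.
* If `-1` is not a square, then `-1 = u ^ 2 + v ^ 2` with `u`, `v` nonzero; take `s = - u ^ 2` and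
  `x = 0`.
* Otherwise `-1` is a square and `3` is not; suitable rational `s` and `x` depend on whether `2` and
  `5` are squares. -/
theorem exists_reducedDegree_of_char (hq : 3 < Fintype.card F) (h2 : (2 : F) ≠ 0)
    (h3 : (3 : F) ≠ 0) (h5 : (5 : F) ≠ 0) :
    ∃ θ : F → F, IsOrthomorphism θ ∧ reducedDegree θ + 3 = Fintype.card F := by
  classical
  by_cases hsq3 : IsSquare (-3 : F)
  · obtain ⟨r, hr⟩ := hsq3
    refine exists_reducedDegree_of_sq_sub_add_one hq (s := (1 + r) / 2) ?_
    field_simp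
    linear_combination -hr
  by_cases hsq1 : IsSquare (-1 : F)
  swap
  · obtain ⟨p, hp⟩ := CharP.exists F
    have : NeZero p := ⟨CharP.char_ne_zero_of_finite F p⟩
    obtain ⟨u, v, huv⟩ := CharP.sq_add_sq F p (-1)
    push_cast at huv
    have hu : (u : F) ≠ 0 := by
      intro h
      exact hsq1 ⟨v, by rw [← huv, h]; ring⟩
    have hv : (v : F) ≠ 0 := by
      intro h
      exact hsq1 ⟨u, by rw [← huv, h]; ring⟩
    refine exists_reducedDegree_of_not_isSquare hq (s := -(u : F) ^ 2) (x := 0) IsSquare.zero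
      (not_isSquare_of_eq_mul_sq hsq1 hv ?_) (not_isSquare_of_eq_mul_sq hsq1 hu ?_)
      (not_isSquare_of_eq_mul_sq hsq1 (mul_ne_zero hu hv) ?_)
    · linear_combination huv
    · ring
    · linear_combination (u : F) ^ 2 * huv
  obtain ⟨i, hi⟩ := hsq1
  have hi0 : i ≠ 0 := by rintro rfl; simp at hi
  have hn3 : ¬IsSquare (3 : F) := by
    rintro ⟨r, hr⟩
    exact hsq3 ⟨i * r, by linear_combination 3 * hi + i * i * hr⟩
  have h4 : (4 : F) ≠ 0 := by
    rw [show (4 : F) = 2 * 2 by norm_num]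
    exact mul_ne_zero h2 h2
  have h8 : (8 : F) ≠ 0 := by
    rw [show (8 : F) = 2 * 4 by norm_num]
    exact mul_ne_zero h2 h4
  by_cases hsq2 : IsSquare (2 : F)
  · obtain ⟨w, hw⟩ := hsq2
    have hw0 : w ≠ 0 := by rintro rfl; exact h2 (by simpa using hw)
    by_cases hsq5 : IsSquare (5 : F)
    · obtain ⟨v, hv⟩ := hsq5
      have hv0 : v ≠ 0 := by rintro rfl; exact h5 (by simpa using hv)
      refine exists_reducedDegree_of_not_isSquare hq (s := -1 / 4) (x := -2 / 5)
        ⟨i * w / v, ?_⟩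
        (not_isSquare_of_eq_mul_sq hn3 (r := 3 / (2 * v)) (by simp [*]) ?_)
        (not_isSquare_of_eq_mul_sq hn3 (r := i * w / 4) (by simp [*]) ?_)
        (not_isSquare_of_eq_mul_sq hn3 (r := i / 4) (by simp [*]) ?_)
      · field_simp
        linear_combination 2 * hv + 5 * w ^ 2 * hi - 5 * hw
      · field_simp
        linear_combination -108 * hv
      · field_simp
        linear_combination 15 * w ^ 2 * hi - 15 * hw
      · field_simp
        linear_combination 15 * hi
    · refine exists_reducedDegree_of_not_isSquare hq (s := -1 / 4) (x := 2) ⟨w, hw⟩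
        (not_isSquare_of_eq_mul_sq hn3 (r := 1 / 2) (by simp [*]) ?_)
        (not_isSquare_of_eq_mul_sq hn3 (r := w / 4) (by simp [*]) ?_)
        (not_isSquare_of_eq_mul_sq hsq5 (r := 3 / 4) (by simp [*]) ?_)
      · field_simp
        norm_num
      · field_simp
        linear_combination 3 * hw
      · field_simp
        norm_num
  · have hsq6 : IsSquare (2 * 3 : F) := by
      rw [← quadraticChar_one_iff_isSquare (mul_ne_zero h2 h3), map_mul,
        quadraticChar_neg_one_iff_not_isSquare.2 hsq2, quadraticChar_neg_one_iff_not_isSquare.2 hn3]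
      norm_num
    obtain ⟨w, hw⟩ := hsq6
    refine exists_reducedDegree_of_not_isSquare hq (s := -1 / 2) (x := -3 / 8) ⟨i * w / 4, ?_⟩
      (not_isSquare_of_eq_mul_sq hn3 (r := 3 / 4) (by simp [*]) ?_)
      (not_isSquare_of_eq_mul_sq hsq2 (r := 5 * i / 8) (by simp [*]) ?_)
      (not_isSquare_of_eq_mul_sq hn3 (r := 1 / 4) (by simp [*]) ?_)
    · field_simp
      linear_combination 8 * w ^ 2 * hi - 8 * hw
    · field_simp
      norm_num
    · field_simp
      linear_combination 200 * hi
    · field_simp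
      norm_num

end Quadratic

/-! ### The fields with 3, 5 and 8 elements -/

theorem IsOrthomorphism.comp_add_add_const {F : Type*} [Field F] {φ : F → F}
    (hφ : IsOrthomorphism φ) (a b : F) :
    IsOrthomorphism fun x => φ (x + a) + b := by
  refine ⟨(Equiv.addRight b).bijective.comp (hφ.1.comp (Equiv.addRight a).bijective), ?_⟩
  have h := (Equiv.addRight (a + b)).bijective.comp (hφ.2.comp (Equiv.addRight a).bijective)
  convert h using 1
  funext x
  simp
  ring

section Exceptional

variable {F : Type*} [Field F] [Fintype F]

/-- In the cube of a polynomial `c x ^ 5 + e x ^ 3 + g x ^ 2 + h x` only the monomial `x ^ 7`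
contributes to the sum over a field with eight elements. -/
theorem sum_cube_of_card_eq_eight (h8 : Fintype.card F = 8) (c e g h : F) :
    ∑ x : F, (c * x ^ 5 + e * x ^ 3 + g * x ^ 2 + h * x) ^ 3
      = -(3 * (e ^ 2 * h + g ^ 2 * e + h ^ 2 * c)) := by
  have hx : ∀ x : F, x ^ 8 = x := fun x => h8 ▸ FiniteField.pow_card x
  have hS : ∀ k, k < 7 → ∑ x : F, x ^ k = 0 := fun k hk =>
    FiniteField.sum_pow_lt_card_sub_one F k (by omega)
  have h7 : ∑ x : F, x ^ 7 = -1 := by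
    have := sum_pow_card_sub_one (F := F)
    rwa [h8] at this
  have hred : ∀ k, ∑ x : F, x ^ (k + 8) = ∑ x : F, x ^ (k + 1) := fun k =>
    Finset.sum_congr rfl fun x _ => by rw [pow_add, hx, pow_succ]
  have h15 : ∑ x : F, x ^ 15 = 0 := by rw [hred 7, hred 0, hS 1 (by norm_num)]
  have hexp : ∀ x : F, (c * x ^ 5 + e * x ^ 3 + g * x ^ 2 + h * x) ^ 3 =
      h ^ 3 * x ^ 3 + 3 * h ^ 2 * g * x ^ 4 + (3 * g ^ 2 * h + 3 * h ^ 2 * e) * x ^ 5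
      + (g ^ 3 + 6 * e * g * h) * x ^ 6 + 3 * (e ^ 2 * h + g ^ 2 * e + h ^ 2 * c) * x ^ 7
      + (3 * e ^ 2 * g + 6 * c * g * h) * x ^ 8 + (e ^ 3 + 3 * g ^ 2 * c + 6 * c * e * h) * x ^ 9
      + 6 * c * e * g * x ^ 10 + (3 * c ^ 2 * h + 3 * e ^ 2 * c) * x ^ 11
      + 3 * c ^ 2 * g * x ^ 12 + 3 * c ^ 2 * e * x ^ 13 + c ^ 3 * x ^ 15 := fun x => by ring
  simp only [hexp, Finset.sum_add_distrib, ← Finset.mul_sum, h15, h7, hred 0, hred 1, hred 2,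
    hred 3, hred 4, hred 5, Nat.reduceAdd, hS _ (by norm_num : 1 < 7), hS _ (by norm_num : 2 < 7),
    hS _ (by norm_num : 3 < 7), hS _ (by norm_num : 4 < 7), hS _ (by norm_num : 5 < 7),
    hS _ (by norm_num : 6 < 7)]
  ring

theorem two_eq_zero_of_card_eq_eight (h8 : Fintype.card F = 8) : (2 : F) = 0 := by
  have h : ((8 : ℕ) : F) = 0 := h8 ▸ FiniteField.cast_card_eq_zero F
  have h' : (2 : F) ^ 3 = 0 := by
    rw [← h]
    norm_num
  exact pow_eq_zero_iff (by norm_num) |>.1 h'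

/-- The cubes of the values of `φ` and of `φ - id` sum to zero, which leaves, up to scaling, only
`φ x = x ^ 5 + x ^ 3 + (k + k ^ 2) x ^ 2 + k ^ 2 x`; this takes the same value at `k` and `k ^ 2`,
and for `k = 0` and `k = 1` one of `φ` and `φ - id` is `x ^ 5 + x ^ 3`, with roots `0` and `1`. -/
theorem not_isOrthomorphism_of_card_eq_eight (h8 : Fintype.card F = 8) {c e g h : F} (hc : c ≠ 0)
    {φ : F → F} (hφ : ∀ x, φ x = c * x ^ 5 + e * x ^ 3 + g * x ^ 2 + h * x) :
    ¬IsOrthomorphism φ := by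
  intro hort
  have h2 := two_eq_zero_of_card_eq_eight h8
  have : CharP F 2 := CharTwo.of_one_ne_zero_of_two_eq_zero one_ne_zero h2
  have hcube : ∑ x : F, x ^ 3 = 0 := FiniteField.sum_pow_lt_card_sub_one F 3 (by omega)
  have hx8 : ∀ x : F, x ^ 8 = x := fun x => h8 ▸ FiniteField.pow_card x
  have hsqrt : ∀ x : F, ∃ y, y ^ 2 = x := fun x => ⟨x ^ 4, by rw [← pow_mul, hx8]⟩
  have h1 : 3 * (e ^ 2 * h + g ^ 2 * e + h ^ 2 * c) = 0 := by
    have hs := hort.1.sum_comp (fun x : F => x ^ 3)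
    simp only [hφ] at hs
    rw [sum_cube_of_card_eq_eight h8, hcube] at hs
    linear_combination -hs
  have h1' : 3 * (e ^ 2 * (h - 1) + g ^ 2 * e + (h - 1) ^ 2 * c) = 0 := by
    have hs := hort.2.sum_comp (fun x : F => x ^ 3)
    have hφ' : ∀ x, φ x - x = c * x ^ 5 + e * x ^ 3 + g * x ^ 2 + (h - 1) * x := by
      intro x
      rw [hφ]
      ring
    simp only [hφ'] at hs
    rw [sum_cube_of_card_eq_eight h8, hcube] at hs
    linear_combination -hs
  have hce : c = e ^ 2 := by
    linear_combination h1' - h1 + (e ^ 2 - c + 3 * h * c) * h2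
  have he : e ≠ 0 := by
    rintro rfl
    exact hc (by simpa using hce)
  obtain ⟨n, rfl⟩ := hsqrt e
  obtain ⟨k, rfl⟩ := hsqrt h
  have hn : n ≠ 0 := by
    rintro rfl
    exact he (by norm_num)
  have hg : g = n * (k + k ^ 2) := by
    apply CharTwo.sq_injective
    apply mul_left_cancel₀ he
    simp only
    grind
  have hval : ∀ y, n * φ (y / n) = y ^ 5 + y ^ 3 + (k + k ^ 2) * y ^ 2 + k ^ 2 * y := by
    intro y
    rw [hφ, hce, hg]
    field_simp
  have hinj : ∀ y z, n * φ (y / n) = n * φ (z / n) → y = z := fun y z hyz =>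
    (div_left_inj' hn).1 (hort.1.injective (mul_left_cancel₀ hn hyz))
  have hk : k = k ^ 2 := by
    apply hinj
    rw [hval, hval]
    have := hx8 k
    grind
  have hk01 : k * (k - 1) = 0 := by linear_combination -hk
  rcases mul_eq_zero.1 hk01 with hk0 | hk1
  · refine zero_ne_one (hinj 0 1 ?_)
    rw [hval, hval, hk0]
    linear_combination -h2
  · have hval0 := hval 0
    have hval1 := hval 1
    rw [sub_eq_zero.1 hk1] at hval0 hval1
    have h0 : φ (0 / n) - 0 / n = φ (1 / n) - 1 / n := by
      apply mul_left_cancel₀ hn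
      rw [mul_sub, mul_sub, hval0, hval1]
      field_simp
      linear_combination -2 * h2
    have h01 := hort.2.injective h0
    field_simp at h01
    exact zero_ne_one h01

theorem IsOrthomorphism.reducedDegree_ne_five_of_card_eq_eight (h8 : Fintype.card F = 8)
    {φ : F → F} (hφ : IsOrthomorphism φ) : reducedDegree φ ≠ 5 := by
  intro hdeg
  have h2 := two_eq_zero_of_card_eq_eight h8
  set f := reducedPolynomial φ with hf
  have hd : f.natDegree = 5 := hdeg
  have hval : ∀ x, φ x = f.coeff 0 + f.coeff 1 * x + f.coeff 2 * x ^ 2 + f.coeff 3 * x ^ 3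
      + f.coeff 4 * x ^ 4 + f.coeff 5 * x ^ 5 := by
    intro x
    rw [← eval_reducedPolynomial φ x, ← hf, eval_eq_sum_range, hd]
    simp [Finset.sum_range_succ]
  have h5 : f.coeff 5 ≠ 0 := by
    rw [← hd]
    refine leadingCoeff_ne_zero.2 ?_
    intro h
    simp [h] at hd
  generalize f.coeff 0 = a₀ at *
  generalize f.coeff 1 = a₁ at *
  generalize f.coeff 2 = a₂ at *
  generalize f.coeff 3 = a₃ at *
  generalize f.coeff 4 = a₄ at *
  generalize f.coeff 5 = a₅ at *
  -- A translation removes the monomial `x ^ 4`.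
  obtain ⟨t, ht⟩ : ∃ t, a₅ * t = a₄ := ⟨_, mul_div_cancel₀ _ h5⟩
  refine not_isOrthomorphism_of_card_eq_eight h8 (φ := fun x => φ (x + t) + φ t) (c := a₅)
    (e := a₃) (g := a₂ + a₃ * t) (h := a₁ + a₃ * t ^ 2 + a₅ * t ^ 4) h5 ?_
    (hφ.comp_add_add_const t (φ t))
  intro x
  simp only [hval, ← ht]
  grind

theorem IsOrthomorphism.reducedDegree_ne_two_of_card_eq_five (h5 : Fintype.card F = 5)
    {φ : F → F} (hφ : IsOrthomorphism φ) : reducedDegree φ ≠ 2 := by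
  intro hdeg
  have h5' : (5 : F) = 0 := by
    have h : ((5 : ℕ) : F) = 0 := h5 ▸ FiniteField.cast_card_eq_zero F
    exact_mod_cast h
  set f := reducedPolynomial φ with hf
  have hd : f.natDegree = 2 := hdeg
  have hval : ∀ x, φ x = f.coeff 0 + f.coeff 1 * x + f.coeff 2 * x ^ 2 := by
    intro x
    rw [← eval_reducedPolynomial φ x, ← hf, eval_eq_sum_range, hd]
    simp [Finset.sum_range_succ]
  have h2 : f.coeff 2 ≠ 0 := by
    rw [← hd]
    refine leadingCoeff_ne_zero.2 ?_
    intro h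
    simp [h] at hd
  -- The values are symmetric about the vertex of the parabola.
  obtain ⟨t, ht⟩ : ∃ t, f.coeff 2 * t = f.coeff 1 := ⟨_, mul_div_cancel₀ _ h2⟩
  have hsym : ∀ x, x = -t - x := by
    intro x
    apply hφ.1.injective
    rw [hval, hval]
    linear_combination (-2 * x - t) * ht
  have h0 := hsym 0
  have h1 := hsym 1
  exact one_ne_zero (α := F) (by linear_combination h5' - 2 * h1 + 2 * h0)

theorem not_injective_of_reducedDegree_eq_zero {φ : F → F} (h : reducedDegree φ = 0) :
    ¬Function.Injective φ := by
  intro hφ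
  refine zero_ne_one (hφ (?_ : φ 0 = φ 1))
  rw [← eval_reducedPolynomial φ 0, ← eval_reducedPolynomial φ 1, eq_C_of_natDegree_eq_zero h]
  simp

end Exceptional

/-! ### Orthomorphisms of reduced degree `q - 3` -/

theorem exists_reducedDegree_of_card {F : Type*} [Field F] [Fintype F]
    (hF : Fintype.card F ∉ ({2, 3, 5, 8} : Set ℕ)) :
    ∃ θ : F → F, IsOrthomorphism θ ∧ reducedDegree θ + 3 = Fintype.card F := by
  simp only [Set.mem_insert_iff, Set.mem_singleton_iff, not_or] at hF
  have hq : 3 < Fintype.card F := by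
    have := Fintype.one_lt_card (α := F)
    omega
  obtain ⟨p, hp⟩ := CharP.exists F
  have hprime : p.Prime := CharP.char_is_prime F p
  have : Fact p.Prime := ⟨hprime⟩
  let _ : Algebra (ZMod p) F := ZMod.algebra F p
  have hcard : Fintype.card F = p ^ Module.finrank (ZMod p) F := by
    rw [Module.card_eq_pow_finrank (K := ZMod p), ZMod.card]
  rcases lt_or_ge (Module.finrank (ZMod p) F) 2 with hm | hm
  · have h1 : Fintype.card F = p := by
      have := Module.finrank_pos (R := ZMod p) (M := F)
      rw [hcard, show Module.finrank (ZMod p) F = 1 by omega, pow_one]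
    have key : ∀ r : ℕ, r.Prime → p ≠ r → (r : F) ≠ 0 := by
      intro r hr hpr h
      rw [CharP.cast_eq_zero_iff F p, Nat.prime_dvd_prime_iff_eq hprime hr] at h
      exact hpr h
    refine exists_reducedDegree_of_char hq ?_ ?_ ?_
    · exact_mod_cast key 2 (by norm_num) (by omega)
    · exact_mod_cast key 3 (by norm_num) (by omega)
    · exact_mod_cast key 5 (by norm_num) (by omega)
  · refine exists_reducedDegree_of_two_le_finrank p hq hm ?_
    rintro ⟨h2, h3⟩
    rw [h3, h2] at hcard
    omega

theorem theorem1p2 (F : Type*) [Field F] [Fintype F] :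
    ((∃ f : F[X], IsOrthomorphismPolynomial f ∧
        reducedDegree (fun x : F => f.eval x) + 3 = Fintype.card F) ↔
      Fintype.card F ∉ ({2, 3, 5, 8} : Set ℕ)) ∧
    (3 < Fintype.card F → ∀ f : F[X], IsOrthomorphismPolynomial f →
      reducedDegree (fun x : F => f.eval x) + 3 ≤ Fintype.card F) := by
  refine ⟨⟨?_, fun hF => ?_⟩, fun hq f hf => ?_⟩
  · rintro ⟨f, hf, hd⟩ hF
    have hort : IsOrthomorphism fun x : F => f.eval x := hf
    simp only [Set.mem_insert_iff, Set.mem_singleton_iff] at hF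
    rcases hF with h | h | h | h
    · omega
    · exact not_injective_of_reducedDegree_eq_zero (by omega) hort.1.injective
    · exact hort.reducedDegree_ne_two_of_card_eq_five h (by omega)
    · exact hort.reducedDegree_ne_five_of_card_eq_eight h (by omega)
  · obtain ⟨θ, hθ, hd⟩ := exists_reducedDegree_of_card hF
    have h : (fun x : F => (reducedPolynomial θ).eval x) = θ :=
      funext (eval_reducedPolynomial θ)
    have hort : IsOrthomorphism fun x : F => (reducedPolynomial θ).eval x := by rwa [h]
    exact ⟨reducedPolynomial θ, hort, by rwa [h]⟩
  · exact IsOrthomorphism.reducedDegree_le (φ := fun x : F => f.eval x) hf hq
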